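/- **Proposition (Explicit case, $m=n$, $D_1=\lambda D_0$).** Let $\mu=\mathcal N(m_0,\Sigma_0)$ and $\nu=\mathcal N(m_1,\Sigma_1)$ be two Gaussian measures on $\mathbb R^n$, where $\Sigma_0,\Sigma_1$ are symmetric positive semidefinite and $\Sigma_0$ is non-singular. Let $\Sigma_0=P_0D_0P_0^T$ and $\Sigma_1=P_1D_1P_1^T$ be diagonalizations, with $P_0,P_1$ orthogonal and $D_0,D_1$ diagonal with diagonal entries in non-increasing order, and suppose that $D_1=\lambda D_0$ for some $\lambda\ge 0$. Let $\Pi(\mu,\nu)$ be the set of measures on $\mathbb R^n\times\mathbb R^n$ with marginals $\mu$ and $\nu$, let $\mathcal N_{2n}$ be the set of (possibly degenerate) Gaussian measures on $\mathbb R^{2n}$, let $\|M\|_F=\sqrt{\operatorname{tr}(M^TM)}$, and set $$J(\pi)=\iint\bigl(\|x-x'\|^2-\|y-y'\|^2\bigr)^2\,d\pi(x,y)\,d\pi(x',y'),$$ $$GW_2^2(\mu,\nu)=\inf_{\pi\in\Pi(\mu,\nu)}J(\pi),\qquad GGW_2^2(\mu,\nu)=\inf_{\pi\in\Pi(\mu,\nu)\cap\mathcal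 N_{2n}}J(\pi),$$ $$LGW_2^2(\mu,\nu)=4(\operatorname{tr}D_0-\operatorname{tr}D_1)^2+4(\|D_0\|_F-\|D_1\|_F)^2+4\|D_0-D_1\|_F^2.$$ Then $$GW_2^2(\mu,\nu)=GGW_2^2(\mu,\nu)=LGW_2^2(\mu,\nu)=(\lambda-1)^2\bigl(4(\operatorname{tr}\Sigma_0)^2+8\|\Sigma_0\|_F^2\bigr).$$ Moreover, for every matrix $\tilde I=\operatorname{diag}(\pm1,\dots,\pm1)$ of size $n$, with any choice of signs, the affine map $$T(x)=m_1+\sqrt\lambda\,P_1\tilde I P_0^T(x-m_0)$$ yields a Gaussian transport plan $\pi^*=(\mathrm{id},T)\#\mu\in\Pi(\mu,\nu)\cap\mathcal N_{2n}$ with $J(\pi^*)=GW_2^2(\mu,\nu)$, i.e. $\pi^*$ is optimal both for $GW_2^2$ and for $GGW_2^2$. -/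

import Mathlib

open MeasureTheory ProbabilityTheory
open scoped ENNReal

noncomputable section

/-- The Frobenius norm `√(tr(Mᵀ M))` of a real matrix. -/
def frobNorm {m n : ℕ} (M : Matrix (Fin m) (Fin n) ℝ) : ℝ :=
  Real.sqrt (M.transpose * M).trace

/-- `(P, D)` is a diagonalization `S = P D Pᵀ` of `S`, with `P` orthogonal and `D` diagonal,
which sorts the eigenvalues in non-increasing order. -/
structure IsSortedDiagonalization {n : ℕ} (S P D : Matrix (Fin n) (Fin n) ℝ) : Prop where
  orthogonal : P ∈ Matrix.orthogonalGroup (Fin n) ℝ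
  isDiag : D.IsDiag
  sorted : Antitone D.diag
  eq : S = P * D * P.transpose

/-- The transport plans between `μ` and `ν`: measures on the product with marginals `μ` and `ν`. -/
def transportPlans {m n : ℕ} (μ : Measure (EuclideanSpace ℝ (Fin m)))
    (ν : Measure (EuclideanSpace ℝ (Fin n))) :
    Set (Measure (EuclideanSpace ℝ (Fin m) × EuclideanSpace ℝ (Fin n))) :=
  {π | π.fst = μ ∧ π.snd = ν}

/-- The transport plans between `μ` and `ν` that are (possibly degenerate) Gaussian measures. -/
def gaussianTransportPlans {m n : ℕ} (μ : Measure (EuclideanSpace ℝ (Fin m)))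
    (ν : Measure (EuclideanSpace ℝ (Fin n))) :
    Set (Measure (EuclideanSpace ℝ (Fin m) × EuclideanSpace ℝ (Fin n))) :=
  {π | π ∈ transportPlans μ ν ∧ IsGaussian π}

/-- The Gromov-Wasserstein objective
`∫∫ (‖x - x'‖² - ‖y - y'‖²)² dπ(x,y) dπ(x',y')`, with values in `[0, ∞]`. -/
def gwObjective {m n : ℕ}
    (π : Measure (EuclideanSpace ℝ (Fin m) × EuclideanSpace ℝ (Fin n))) : ℝ≥0∞ :=
  ∫⁻ z, ∫⁻ z', ENNReal.ofReal ((‖z.1 - z'.1‖ ^ 2 - ‖z.2 - z'.2‖ ^ 2) ^ 2) ∂π ∂π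

/-- `GW₂²(μ, ν)`. -/
def GW2sq {m n : ℕ} (μ : Measure (EuclideanSpace ℝ (Fin m)))
    (ν : Measure (EuclideanSpace ℝ (Fin n))) : ℝ≥0∞ :=
  ⨅ π ∈ transportPlans μ ν, gwObjective π

/-- `GGW₂²(μ, ν)`: the problem restricted to Gaussian transport plans. -/
def GGW2sq {m n : ℕ} (μ : Measure (EuclideanSpace ℝ (Fin m)))
    (ν : Measure (EuclideanSpace ℝ (Fin n))) : ℝ≥0∞ :=
  ⨅ π ∈ gaussianTransportPlans μ ν, gwObjective π

/-- The submatrix of the `n` first rows and columns of a square matrix of size `m ≥ n`. -/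
def leadingBlock {m n : ℕ} (h : n ≤ m) (A : Matrix (Fin m) (Fin m) ℝ) :
    Matrix (Fin n) (Fin n) ℝ :=
  A.submatrix (Fin.castLE h) (Fin.castLE h)

/-- `LGW₂²` of two Gaussian measures on `ℝᵐ` and `ℝⁿ`, `n ≤ m`, in terms of the diagonal matrices
`D₀` and `D₁` of the eigenvalues, in non-increasing order, of their covariance matrices. -/
def LGW2sq {m n : ℕ} (h : n ≤ m) (D₀ : Matrix (Fin m) (Fin m) ℝ)
    (D₁ : Matrix (Fin n) (Fin n) ℝ) : ℝ :=
  4 * (D₀.trace - D₁.trace) ^ 2 + 4 * (frobNorm D₀ - frobNorm D₁) ^ 2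
    + 4 * frobNorm (leadingBlock h D₀ - D₁) ^ 2
    + 4 * (frobNorm D₀ ^ 2 - frobNorm (leadingBlock h D₀) ^ 2)

end

/-! For a plan `π`, regard `f = ‖x - x'‖²` and `g = ‖y - y'‖²` as elements of `L²(π ⊗ π)`, so that
the objective is `‖f - g‖²`. The norms of `f` and `g` depend only on the marginals, and the reverse
triangle inequality bounds the objective below by `(‖f‖ - ‖g‖)²` for every plan, Gaussian or not
(`ofReal_sub_one_sq_mul_le_gwObjective`).

The norms are explicit: `x - x'` is `√2` times a centred Gaussian, so in an eigenbasis `f` has the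
law of `2 ∑ dᵢ zᵢ²`, and `‖f‖² = K = 4 (∑ dᵢ)² + 8 ∑ dᵢ²` (`lintegral_lintegral_norm_sub_pow_four`).
Since `D₁ = λ D₀`, `‖g‖ = λ √K`, and the bound is `(λ - 1)² K`.

Equality needs `g = λ f`, which holds on the graph of any map scaling squared distances by `λ`
(`gwObjective_map_prodMk`). The maps `T` do so and push `μ` to `ν`; being affine, they give Gaussian
plans, so both infima equal the bound. -/

/-! ### Moments of weighted sums of squared standard Gaussians -/

/-- The fourth moment of the standard real Gaussian distribution. -/
theorem integral_pow_four_gaussianReal : ∫ x, x ^ 4 ∂(gaussianReal 0 1) = 3 := by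
  -- The mgf is `exp (t² / 2)`; its derivatives keep the form polynomial times `exp (t² / 2)`, under
  -- the recursion `p ↦ p' + X p`.
  have key : ∀ p : Polynomial ℝ, deriv (fun t ↦ p.eval t * Real.exp (t ^ 2 / 2)) =
      fun t ↦ (p.derivative + Polynomial.X * p).eval t * Real.exp (t ^ 2 / 2) := by
    intro p
    ext t
    have h1 : HasDerivAt (fun t : ℝ ↦ t ^ 2 / 2) t t := by
      simpa using ((hasDerivAt_id t).pow 2).div_const 2
    refine ((p.hasDerivAt t).mul h1.exp).deriv.trans ?_
    simp only [Polynomial.eval_add, Polynomial.eval_mul, Polynomial.eval_X]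
    ring
  have h := iteratedDeriv_mgf_zero (X := fun x : ℝ ↦ x) (μ := gaussianReal 0 1) (by simp) 4
  have e0 : mgf (fun x : ℝ ↦ x) (gaussianReal 0 1) =
      fun t ↦ (1 : Polynomial ℝ).eval t * Real.exp (t ^ 2 / 2) := by
    rw [mgf_fun_id_gaussianReal]
    simp
  simp only [iteratedDeriv_succ, iteratedDeriv_zero] at h
  rw [e0, key, key, key, key] at h
  refine Eq.trans ?_ (h.symm.trans ?_)
  · rfl
  · simp
    norm_num

/-- The second moment of the standard real Gaussian distribution. -/
theorem integral_sq_gaussianReal : ∫ x, x ^ 2 ∂(gaussianReal 0 1) = 1 := by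
  have h := variance_eq_sub (μ := gaussianReal 0 1) (X := fun x ↦ x)
    (memLp_id_gaussianReal 2)
  simpa using h.symm

/-- The square of a standard Gaussian variable is square integrable. -/
theorem memLp_sq_gaussianReal : MemLp (fun x : ℝ ↦ x ^ 2) 2 (gaussianReal 0 1) := by
  refine (memLp_two_iff_integrable_sq (by fun_prop)).2 ?_
  have h := (memLp_id_gaussianReal (μ := 0) (v := 1) 4).integrable_norm_pow' (p := 4)
  refine h.congr (.of_forall fun x ↦ ?_)
  simp only [id, Real.norm_eq_abs, ← pow_mul]
  exact (even_two.mul_left 2).pow_abs x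

/-- The square of a standard Gaussian variable has variance `2`. -/
theorem variance_sq_gaussianReal : Var[fun x : ℝ ↦ x ^ 2; gaussianReal 0 1] = 2 := by
  rw [variance_eq_sub memLp_sq_gaussianReal]
  simp only [Pi.pow_apply, ← pow_mul]
  rw [integral_pow_four_gaussianReal, integral_sq_gaussianReal]
  norm_num

section
variable {ι : Type*} [Fintype ι]

/-- A weighted sum of squares of independent standard Gaussian variables is square integrable. -/
theorem memLp_sum_mul_sq_pi_gaussianReal (d : ι → ℝ) :
    MemLp (fun z : ι → ℝ ↦ ∑ i, d i * z i ^ 2) 2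
      (Measure.pi fun _ : ι ↦ gaussianReal 0 1) :=
  memLp_finsetSum _ fun i _ ↦ (memLp_sq_gaussianReal.comp_measurePreserving
    (measurePreserving_eval (fun _ : ι ↦ gaussianReal 0 1) i)).const_mul (d i)

/-- The second moment of a weighted sum of squares of independent standard Gaussian variables. -/
theorem integral_sq_sum_mul_sq_pi_gaussianReal (d : ι → ℝ) :
    ∫ z : ι → ℝ, (∑ i, d i * z i ^ 2) ^ 2 ∂(Measure.pi fun _ : ι ↦ gaussianReal 0 1)
      = (∑ i, d i) ^ 2 + 2 * ∑ i, d i ^ 2 := by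
  -- Second moment as variance plus squared mean; by independence the variances `2 dᵢ²` add up.
  have hv := variance_eq_sub (memLp_sum_mul_sq_pi_gaussianReal d)
  have hs := variance_sum_pi (μ := fun _ : ι ↦ gaussianReal 0 1)
    (X := fun i x ↦ d i * x ^ 2) (fun i ↦ memLp_sq_gaussianReal.const_mul (d i))
  have hfun : (∑ i, fun ω : ι → ℝ ↦ d i * ω i ^ 2) = fun z ↦ ∑ i, d i * z i ^ 2 := by
    ext z; simp
  have hm : ∫ z : ι → ℝ, ∑ i, d i * z i ^ 2 ∂(Measure.pi fun _ : ι ↦ gaussianReal 0 1)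
      = ∑ i, d i := by
    rw [integral_finsetSum _ fun i _ ↦ integrable_comp_eval
      (μ := fun _ : ι ↦ gaussianReal 0 1) (i := i)
      (f := fun x : ℝ ↦ d i * x ^ 2) ((memLp_sq_gaussianReal.integrable one_le_two).const_mul _)]
    refine Finset.sum_congr rfl fun i _ ↦ ?_
    rw [integral_comp_eval (μ := fun _ : ι ↦ gaussianReal 0 1) (i := i)
      (f := fun x : ℝ ↦ d i * x ^ 2) (by fun_prop), integral_const_mul,
      integral_sq_gaussianReal, mul_one]
  rw [hfun, hv, hm] at hs
  simp only [variance_const_mul, variance_sq_gaussianReal, Pi.pow_apply, ← Finset.sum_mul] at hs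
  linarith

end

/-! ### Gaussian measures as affine images of the standard one -/

open Matrix in
/-- An affine image of the standard Gaussian measure is a multivariate Gaussian measure. -/
theorem map_affine_stdGaussian {ι κ : Type*} [Fintype ι] [DecidableEq ι] [Fintype κ]
    [DecidableEq κ]
    (m : EuclideanSpace ℝ ι) (B : Matrix ι κ ℝ) :
    (stdGaussian (EuclideanSpace ℝ κ)).map (fun z ↦ m + Matrix.toEuclideanLin B z)
      = multivariateGaussian m (B * B.transpose) := by
  have hB : (B * B.transpose).PosSemidef := by
    simpa using posSemidef_self_mul_conjTranspose B
  let L : EuclideanSpace ℝ κ →L[ℝ] EuclideanSpace ℝ ι :=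
    (Matrix.toEuclideanLin B).toContinuousLinearMap
  have hL : (fun z ↦ m + Matrix.toEuclideanLin B z) = (fun x ↦ m + x) ∘ L := rfl
  have hadj : ∀ z t, inner ℝ (L z) t = inner ℝ z (Matrix.toEuclideanLin B.transpose t) := by
    intro z t
    have h := LinearMap.adjoint_inner_right (Matrix.toEuclideanLin B) z t
    rw [← Matrix.toEuclideanLin_conjTranspose_eq_adjoint,
      Matrix.conjTranspose_eq_transpose_of_trivial] at h
    exact h.symm
  have hnorm : ∀ t : EuclideanSpace ℝ ι, ‖Matrix.toEuclideanLin B.transpose t‖ ^ 2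
      = t.ofLp ⬝ᵥ (B * B.transpose).mulVec t.ofLp := by
    intro t
    rw [← real_inner_self_eq_norm_sq, EuclideanSpace.inner_eq_star_dotProduct]
    simp only [ofLp_toLpLin, toLin'_apply, star_trivial]
    rw [← mulVec_mulVec, dotProduct_mulVec _ B, mulVec_transpose]
  apply Measure.ext_of_charFun
  ext t
  rw [charFun_multivariateGaussian hB, hL, ← Measure.map_map (by fun_prop) (by fun_prop),
    charFun_map_const_add, charFun_apply, integral_map (by fun_prop) (by fun_prop)]
  simp only [hadj]
  rw [← charFun_apply, charFun_stdGaussian, ← Complex.ofReal_pow, hnorm, ← Complex.exp_add,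
    real_inner_comm]
  congr 1
  ring

/-- The difference of two independent standard Gaussian vectors is `√2` times a standard Gaussian
vector. -/
theorem map_sub_prod_stdGaussian {E : Type*} [NormedAddCommGroup E] [InnerProductSpace ℝ E]
    [FiniteDimensional ℝ E] [MeasurableSpace E] [BorelSpace E] :
    ((stdGaussian E).prod (stdGaussian E)).map (fun p ↦ p.1 - p.2)
      = (stdGaussian E).map (fun z ↦ Real.sqrt 2 • z) := by
  -- By symmetry the difference has the law of the sum, whose characteristic function is a product.
  have hneg : (stdGaussian E).map (fun z ↦ -z) = stdGaussian E :=
    stdGaussian_map (LinearIsometryEquiv.neg ℝ)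
  have h1 : ((stdGaussian E).prod (stdGaussian E)).map (fun p ↦ p.1 - p.2)
      = ((stdGaussian E).prod (stdGaussian E)).map (fun p ↦ p.1 + p.2) := by
    nth_rw 4 [← hneg]
    conv_rhs => rw [← Measure.map_id (μ := stdGaussian E), Measure.map_map (by fun_prop) (by fun_prop)]
    rw [Measure.map_prod_map _ _ (by fun_prop) (by fun_prop),
      Measure.map_map (by fun_prop) (by fun_prop)]
    congr 1
    ext p
    simp [sub_eq_add_neg]
  rw [h1]
  apply Measure.ext_of_charFun
  rw [charFun_map_add_prod_eq_mul]
  ext t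
  rw [charFun_map_smul, Pi.mul_apply, charFun_stdGaussian, charFun_stdGaussian, ← Complex.exp_add]
  congr 1
  rw [← Complex.ofReal_pow, ← Complex.ofReal_pow, norm_smul, mul_pow, Real.norm_eq_abs, sq_abs,
    Real.sq_sqrt (by norm_num)]
  push_cast
  ring

open Matrix in
/-- `‖P √D z‖² = ∑ dᵢ zᵢ²` when `P` is orthogonal and `D = diag d` is nonnegative. -/
theorem norm_sq_orthogonal_mul_diagonal_sqrt {n : ℕ} {P : Matrix (Fin n) (Fin n) ℝ}
    (hP : P ∈ Matrix.orthogonalGroup (Fin n) ℝ) {d : Fin n → ℝ} (hd : ∀ i, 0 ≤ d i)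
    (z : EuclideanSpace ℝ (Fin n)) :
    ‖Matrix.toEuclideanLin (P * diagonal fun i ↦ √(d i)) z‖ ^ 2 = ∑ i, d i * z i ^ 2 := by
  have hP' : Pᵀ * P = 1 := (mem_orthogonalGroup_iff' (Fin n) ℝ).1 hP
  rw [← real_inner_self_eq_norm_sq, EuclideanSpace.inner_eq_star_dotProduct]
  have h1 : ∀ w : Fin n → ℝ, (P *ᵥ w) ⬝ᵥ (P *ᵥ w) = w ⬝ᵥ w := by
    intro w
    rw [dotProduct_mulVec, ← mulVec_transpose, mulVec_mulVec, hP', one_mulVec]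
  simp only [ofLp_toLpLin, toLin'_apply, star_trivial, ← mulVec_mulVec, h1]
  simp only [dotProduct, mulVec_diagonal]
  refine Finset.sum_congr rfl fun i _ ↦ ?_
  rw [mul_mul_mul_comm, Real.mul_self_sqrt (hd i), pow_two]

open Matrix in
theorem mul_diagonal_mul_transpose_self {n : ℕ} (P : Matrix (Fin n) (Fin n) ℝ) (a : Fin n → ℝ) :
    (P * diagonal a) * (P * diagonal a)ᵀ = P * diagonal (fun i ↦ a i * a i) * Pᵀ := by
  rw [transpose_mul, diagonal_transpose, ← Matrix.mul_assoc, Matrix.mul_assoc P (diagonal a),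
    diagonal_mul_diagonal]

open Matrix in
/-- A Gaussian measure with diagonalized covariance is the image of the standard one under
`z ↦ m + P √D z`. -/
theorem multivariateGaussian_orthogonal_conj_diagonal {n : ℕ} (m : EuclideanSpace ℝ (Fin n))
    (P : Matrix (Fin n) (Fin n) ℝ) {d : Fin n → ℝ} (hd : ∀ i, 0 ≤ d i) :
    multivariateGaussian m (P * diagonal d * Pᵀ) =
      (stdGaussian (EuclideanSpace ℝ (Fin n))).map
        (fun z ↦ m + Matrix.toEuclideanLin (P * diagonal fun i ↦ √(d i)) z) := by
  rw [map_affine_stdGaussian, mul_diagonal_mul_transpose_self]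
  simp only [Real.mul_self_sqrt (hd _)]

/-! ### Fourth moment of the distance between independent Gaussian vectors -/

/-- Change of variables in an iterated lower integral. -/
theorem lintegral_lintegral_map {α β : Type*} [MeasurableSpace α] [MeasurableSpace β]
    {μ : Measure α} [SFinite μ] {T : α → β} (hT : Measurable T) {F : β → β → ℝ≥0∞}
    (hF : Measurable (Function.uncurry F)) :
    ∫⁻ y, ∫⁻ y', F y y' ∂(μ.map T) ∂(μ.map T) = ∫⁻ x, ∫⁻ x', F (T x) (T x') ∂μ ∂μ := by
  rw [lintegral_map hF.lintegral_prod_right hT]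
  exact lintegral_congr fun x ↦ lintegral_map hF.of_uncurry_left hT

theorem measurable_uncurry_norm_sub_pow_four {E : Type*} [NormedAddCommGroup E]
    [MeasurableSpace E] [BorelSpace E] [SecondCountableTopology E] :
    Measurable (Function.uncurry fun x x' : E ↦ ENNReal.ofReal ((‖x - x'‖ ^ 2) ^ 2)) := by
  unfold Function.uncurry
  fun_prop

open Matrix in
/-- The fourth moment of the distance between two independent Gaussian vectors. -/
theorem lintegral_lintegral_norm_sub_pow_four {n : ℕ} (m : EuclideanSpace ℝ (Fin n))
    {P : Matrix (Fin n) (Fin n) ℝ} (hP : P ∈ Matrix.orthogonalGroup (Fin n) ℝ)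
    {d : Fin n → ℝ} (hd : ∀ i, 0 ≤ d i) :
    ∫⁻ x, ∫⁻ x', ENNReal.ofReal ((‖x - x'‖ ^ 2) ^ 2)
        ∂(multivariateGaussian m (P * diagonal d * Pᵀ))
        ∂(multivariateGaussian m (P * diagonal d * Pᵀ)) =
      ENNReal.ofReal (4 * (∑ i, d i) ^ 2 + 8 * ∑ i, d i ^ 2) := by
  set B := Matrix.toEuclideanLin (P * diagonal fun i ↦ √(d i)) with hB
  have hBm : Measurable B := B.continuous_of_finiteDimensional.measurable
  have hmeas : Measurable fun z ↦ m + B z := by fun_prop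
  have hsub : Measurable fun p : EuclideanSpace ℝ (Fin n) × EuclideanSpace ℝ (Fin n) ↦
      p.1 - p.2 := by fun_prop
  let g : EuclideanSpace ℝ (Fin n) → ℝ≥0∞ := fun w ↦ ENNReal.ofReal ((‖B w‖ ^ 2) ^ 2)
  have hg : Measurable g := by fun_prop
  rw [multivariateGaussian_orthogonal_conj_diagonal m P hd, ← hB]
  rw [lintegral_lintegral_map hmeas measurable_uncurry_norm_sub_pow_four]
  have hg' : ∀ z z', ENNReal.ofReal ((‖m + B z - (m + B z')‖ ^ 2) ^ 2) = g (z - z') := by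
    intro z z'
    simp [g]
  simp_rw [hg']
  rw [← lintegral_prod (fun p : EuclideanSpace ℝ (Fin n) × EuclideanSpace ℝ (Fin n) ↦
      g (p.1 - p.2)) (hg.comp hsub).aemeasurable, ← lintegral_map hg hsub,
    map_sub_prod_stdGaussian, lintegral_map hg (by fun_prop), ← map_pi_eq_stdGaussian,
    lintegral_map (by fun_prop) (by fun_prop)]
  -- The scaling by `√2` doubles the squared norm, hence the factor 4 after squaring.
  have hg2 : ∀ z : Fin n → ℝ, g (√2 • WithLp.toLp 2 z) =
      ENNReal.ofReal 4 * ENNReal.ofReal ((∑ i, d i * z i ^ 2) ^ 2) := by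
    intro z
    rw [← ENNReal.ofReal_mul (by norm_num)]
    simp only [g, hB, norm_sq_orthogonal_mul_diagonal_sqrt hP hd]
    congr 1
    simp only [PiLp.smul_apply, smul_eq_mul, mul_pow, Real.sq_sqrt zero_le_two, mul_left_comm _ (2:ℝ),
      ← Finset.mul_sum]
    ring
  simp_rw [hg2]
  rw [lintegral_const_mul _ (by fun_prop), ← ofReal_integral_eq_lintegral_ofReal
    ((memLp_sum_mul_sq_pi_gaussianReal d).integrable_sq) (.of_forall fun _ ↦ sq_nonneg _),
    integral_sq_sum_mul_sq_pi_gaussianReal, ← ENNReal.ofReal_mul (by norm_num)]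
  congr 1
  ring

/-! ### Lower bound for arbitrary plans -/

/-- The squared `L²` norm of a real function as a lower integral. -/
theorem eLpNorm_two_sq_eq_lintegral {α : Type*} [MeasurableSpace α] (μ : Measure α) (f : α → ℝ) :
    eLpNorm f 2 μ ^ 2 = ∫⁻ a, ENNReal.ofReal (f a ^ 2) ∂μ := by
  rw [eLpNorm_eq_lintegral_rpow_enorm_toReal two_ne_zero ENNReal.ofNat_ne_top,
    ← ENNReal.rpow_two, ← ENNReal.rpow_mul]
  norm_num
  refine lintegral_congr fun a ↦ ?_
  rw [← ofReal_norm, ← ENNReal.ofReal_pow (norm_nonneg _), Real.norm_eq_abs, sq_abs]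

/-- Minkowski: if `∫ f² = K` and `∫ g² = c² K` then `∫ (f - g)² ≥ (c - 1)² K`. -/
theorem ofReal_sub_one_sq_mul_le_lintegral {α : Type*} [MeasurableSpace α] {μ : Measure α}
    {f g : α → ℝ} (hf : AEStronglyMeasurable f μ) (hg : AEStronglyMeasurable g μ) {c K : ℝ}
    (hc : 0 ≤ c) (hK : 0 ≤ K) (hfK : ∫⁻ a, ENNReal.ofReal (f a ^ 2) ∂μ = ENNReal.ofReal K)
    (hgK : ∫⁻ a, ENNReal.ofReal (g a ^ 2) ∂μ = ENNReal.ofReal (c ^ 2 * K)) :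
    ENNReal.ofReal ((c - 1) ^ 2 * K) ≤ ∫⁻ a, ENNReal.ofReal ((f a - g a) ^ 2) ∂μ := by
  have hof : ∀ {h : α → ℝ} {r : ℝ}, 0 ≤ r →
      ∫⁻ a, ENNReal.ofReal (h a ^ 2) ∂μ = ENNReal.ofReal (r ^ 2) →
      eLpNorm h 2 μ = ENNReal.ofReal r := by
    intro h r hr hh
    rw [← eLpNorm_two_sq_eq_lintegral, ENNReal.ofReal_pow hr] at hh
    exact (ENNReal.pow_right_strictMono two_ne_zero).injective hh
  have hf2 : eLpNorm f 2 μ = ENNReal.ofReal √K :=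
    hof (Real.sqrt_nonneg K) (by rw [Real.sq_sqrt hK, hfK])
  have hg2 : eLpNorm g 2 μ = ENNReal.ofReal (c * √K) :=
    hof (by positivity) (by rw [mul_pow, Real.sq_sqrt hK, hgK])
  have hfg : MemLp (f - g) 2 μ :=
    MemLp.sub ⟨hf, by simp [hf2]⟩ ⟨hg, by simp [hg2]⟩
  obtain ⟨r, hr, hfgr⟩ : ∃ r : ℝ, 0 ≤ r ∧ eLpNorm (f - g) 2 μ = ENNReal.ofReal r :=
    ⟨_, ENNReal.toReal_nonneg, (ENNReal.ofReal_toReal hfg.eLpNorm_lt_top.ne).symm⟩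
  -- The two triangle inequalities together give `|c - 1| √K ≤ r`, whichever side of 1 `c` lies on.
  have h1 : √K ≤ r + c * √K := by
    have h := eLpNorm_add_le (hf.sub hg) hg (p := 2) (by norm_num)
    rw [sub_add_cancel, hf2, hg2, hfgr, ← ENNReal.ofReal_add hr (by positivity)] at h
    exact (ENNReal.ofReal_le_ofReal_iff (by positivity)).1 h
  have h2 : c * √K ≤ √K + r := by
    have h := eLpNorm_sub_le hf (hf.sub hg) (p := 2) (by norm_num)
    rw [sub_sub_cancel, hf2, hg2, hfgr, ← ENNReal.ofReal_add (Real.sqrt_nonneg K) hr] at h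
    exact (ENNReal.ofReal_le_ofReal_iff (by positivity)).1 h
  have h3 := eLpNorm_two_sq_eq_lintegral μ (f - g)
  simp only [Pi.sub_apply] at h3
  rw [← h3, hfgr, ← ENNReal.ofReal_pow hr]
  refine ENNReal.ofReal_le_ofReal ?_
  have h4 : ((c - 1) * √K) ^ 2 ≤ r ^ 2 := sq_le_sq' (by linarith) (by linarith)
  rwa [mul_pow, Real.sq_sqrt hK] at h4

/-- The lower bound on the Gromov-Wasserstein objective from the fourth moments of the distances
under the marginals. -/
theorem ofReal_sub_one_sq_mul_le_gwObjective {m n : ℕ} {μ : Measure (EuclideanSpace ℝ (Fin m))}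
    {ν : Measure (EuclideanSpace ℝ (Fin n))} [IsProbabilityMeasure μ]
    {π : Measure (EuclideanSpace ℝ (Fin m) × EuclideanSpace ℝ (Fin n))}
    (hπ : π ∈ transportPlans μ ν) {c K : ℝ} (hc : 0 ≤ c) (hK : 0 ≤ K)
    (hμ : ∫⁻ x, ∫⁻ x', ENNReal.ofReal ((‖x - x'‖ ^ 2) ^ 2) ∂μ ∂μ = ENNReal.ofReal K)
    (hν : ∫⁻ y, ∫⁻ y', ENNReal.ofReal ((‖y - y'‖ ^ 2) ^ 2) ∂ν ∂ν = ENNReal.ofReal (c ^ 2 * K)) :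
    ENNReal.ofReal ((c - 1) ^ 2 * K) ≤ gwObjective π := by
  obtain ⟨h1, h2⟩ := hπ
  have : IsProbabilityMeasure π := by
    constructor
    rw [← Measure.fst_univ, h1, measure_univ]
  set f : (EuclideanSpace ℝ (Fin m) × EuclideanSpace ℝ (Fin n)) ×
    (EuclideanSpace ℝ (Fin m) × EuclideanSpace ℝ (Fin n)) → ℝ := fun p ↦ ‖p.1.1 - p.2.1‖ ^ 2
    with hf
  set g : (EuclideanSpace ℝ (Fin m) × EuclideanSpace ℝ (Fin n)) ×
    (EuclideanSpace ℝ (Fin m) × EuclideanSpace ℝ (Fin n)) → ℝ := fun p ↦ ‖p.1.2 - p.2.2‖ ^ 2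
    with hg
  have hfm : Measurable f := by fun_prop
  have hgm : Measurable g := by fun_prop
  have hJ : gwObjective π = ∫⁻ p, ENNReal.ofReal ((f p - g p) ^ 2) ∂(π.prod π) :=
    (lintegral_prod (μ := π) (ν := π) (fun p ↦ ENNReal.ofReal ((f p - g p) ^ 2))
      ((hfm.sub hgm).pow_const 2).ennreal_ofReal.aemeasurable).symm
  rw [hJ]
  refine ofReal_sub_one_sq_mul_le_lintegral hfm.aestronglyMeasurable hgm.aestronglyMeasurable
    hc hK ?_ ?_
  -- `f` sees only the first coordinates, so its norm is an integral against the first marginal;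
  -- likewise `g` and the second.
  · rw [lintegral_prod _ (hfm.pow_const 2).ennreal_ofReal.aemeasurable, ← hμ, ← h1, Measure.fst,
      lintegral_lintegral_map measurable_fst measurable_uncurry_norm_sub_pow_four]
  · rw [lintegral_prod _ (hgm.pow_const 2).ennreal_ofReal.aemeasurable, ← hν, ← h2, Measure.snd,
      lintegral_lintegral_map measurable_snd measurable_uncurry_norm_sub_pow_four]

/-! ### Frobenius norm and diagonalizations -/

theorem frobNorm_sq {m n : ℕ} (M : Matrix (Fin m) (Fin n) ℝ) :
    frobNorm M ^ 2 = (M.transpose * M).trace := by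
  refine Real.sq_sqrt ?_
  simpa using (Matrix.posSemidef_conjTranspose_mul_self M).trace_nonneg

theorem frobNorm_smul {m n : ℕ} (c : ℝ) (M : Matrix (Fin m) (Fin n) ℝ) :
    frobNorm (c • M) = |c| * frobNorm M := by
  simp only [frobNorm, Matrix.transpose_smul, Matrix.smul_mul, Matrix.mul_smul, Matrix.trace_smul,
    smul_eq_mul]
  rw [← mul_assoc, Real.sqrt_mul (mul_self_nonneg c), Real.sqrt_mul_self_eq_abs]

theorem leadingBlock_refl {n : ℕ} (A : Matrix (Fin n) (Fin n) ℝ) :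
    leadingBlock (le_refl n) A = A := rfl

theorem frobNorm_diagonal_sq {n : ℕ} (d : Fin n → ℝ) :
    frobNorm (Matrix.diagonal d) ^ 2 = ∑ i, d i ^ 2 := by
  rw [frobNorm_sq]
  simp [pow_two]

open Matrix in
theorem transpose_mul_self_of_mem_orthogonalGroup {n : ℕ} {P : Matrix (Fin n) (Fin n) ℝ}
    (hP : P ∈ Matrix.orthogonalGroup (Fin n) ℝ) : Pᵀ * P = 1 :=
  (mem_orthogonalGroup_iff' (Fin n) ℝ).1 hP

namespace IsSortedDiagonalization

variable {n : ℕ} {S P D : Matrix (Fin n) (Fin n) ℝ}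

theorem eq_diagonal (h : IsSortedDiagonalization S P D) : D = Matrix.diagonal D.diag :=
  h.isDiag.diagonal_diag.symm

open Matrix in
theorem transpose_mul_mul (h : IsSortedDiagonalization S P D) : Pᵀ * S * P = D := by
  have hP := transpose_mul_self_of_mem_orthogonalGroup h.orthogonal
  rw [h.eq, ← Matrix.mul_assoc, ← Matrix.mul_assoc, hP, Matrix.one_mul, Matrix.mul_assoc, hP,
    Matrix.mul_one]

/-- `D = Pᵀ S P` is congruent to `S`, hence semidefinite. This lets `√D` be a true square root of
`D`. -/
theorem diag_nonneg (h : IsSortedDiagonalization S P D) (hS : S.PosSemidef) (i : Fin n) :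
    0 ≤ D.diag i := by
  have h1 := hS.conjTranspose_mul_mul_same P
  rw [Matrix.conjTranspose_eq_transpose_of_trivial, h.transpose_mul_mul] at h1
  exact h1.diag_nonneg

theorem trace_eq (h : IsSortedDiagonalization S P D) : S.trace = D.trace := by
  rw [h.eq, Matrix.trace_mul_comm, ← Matrix.mul_assoc,
    transpose_mul_self_of_mem_orthogonalGroup h.orthogonal, Matrix.one_mul]

theorem frobNorm_eq (h : IsSortedDiagonalization S P D) : frobNorm S = frobNorm D := by
  have hP := transpose_mul_self_of_mem_orthogonalGroup h.orthogonal
  have h1 : S.transpose * S = P * (D.transpose * D) * P.transpose := by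
    rw [h.eq]
    simp only [Matrix.transpose_mul, Matrix.transpose_transpose, Matrix.mul_assoc]
    rw [← Matrix.mul_assoc P.transpose P, hP, Matrix.one_mul]
  rw [frobNorm, frobNorm, h1, Matrix.trace_mul_comm, ← Matrix.mul_assoc, hP, Matrix.one_mul]

end IsSortedDiagonalization

/-! ### The optimal affine maps and their plans -/

open Matrix in
/-- `√λ P₁ diag(±1) P₀ᵀ` multiplies squared norms by `λ`. -/
theorem norm_sq_sqrt_smul_orthogonal_sign {n : ℕ} {P₀ P₁ : Matrix (Fin n) (Fin n) ℝ}
    (hP₀ : P₀ ∈ Matrix.orthogonalGroup (Fin n) ℝ) (hP₁ : P₁ ∈ Matrix.orthogonalGroup (Fin n) ℝ)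
    {s : Fin n → ℝ} (hs : ∀ i, s i = 1 ∨ s i = -1) {lam : ℝ} (hlam : 0 ≤ lam)
    (x : EuclideanSpace ℝ (Fin n)) :
    ‖√lam • Matrix.toEuclideanLin (P₁ * diagonal s * P₀ᵀ) x‖ ^ 2 = lam * ‖x‖ ^ 2 := by
  have hQ : (P₁ * diagonal s * P₀ᵀ)ᵀ * (P₁ * diagonal s * P₀ᵀ) = 1 := by
    have hss : diagonal s * diagonal s = 1 := by
      rw [diagonal_mul_diagonal, ← diagonal_one]
      congr 1
      ext i
      rcases hs i with h | h <;> simp [h]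
    have hP₀' : P₀ * P₀ᵀ = 1 := (mem_orthogonalGroup_iff (Fin n) ℝ).1 hP₀
    simp only [transpose_mul, transpose_transpose, diagonal_transpose, Matrix.mul_assoc]
    rw [← Matrix.mul_assoc P₁ᵀ P₁, transpose_mul_self_of_mem_orthogonalGroup hP₁, Matrix.one_mul,
      ← Matrix.mul_assoc (diagonal s), hss, Matrix.one_mul, hP₀']
  rw [norm_smul, mul_pow, Real.norm_eq_abs, sq_abs, Real.sq_sqrt hlam,
    ← real_inner_self_eq_norm_sq, ← real_inner_self_eq_norm_sq,
    EuclideanSpace.inner_eq_star_dotProduct, EuclideanSpace.inner_eq_star_dotProduct]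
  simp only [ofLp_toLpLin, toLin'_apply, star_trivial]
  rw [dotProduct_mulVec, ← mulVec_transpose, mulVec_mulVec, hQ, one_mulVec]

open Matrix in
/-- The affine map `x ↦ m₁ + √λ P₁ diag(±1) P₀ᵀ (x - m₀)` transports `N(m₀, P₀ diag(d) P₀ᵀ)` to
`N(m₁, P₁ diag(λ d) P₁ᵀ)`. -/
theorem map_affine_multivariateGaussian_sign {n : ℕ} (m₀ m₁ : EuclideanSpace ℝ (Fin n))
    {P₀ : Matrix (Fin n) (Fin n) ℝ} (hP₀ : P₀ ∈ Matrix.orthogonalGroup (Fin n) ℝ)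
    (P₁ : Matrix (Fin n) (Fin n) ℝ) {d s : Fin n → ℝ} (hd : ∀ i, 0 ≤ d i)
    (hs : ∀ i, s i = 1 ∨ s i = -1) {lam : ℝ} (hlam : 0 ≤ lam) :
    (multivariateGaussian m₀ (P₀ * diagonal d * P₀ᵀ)).map
        (fun x ↦ m₁ + √lam • Matrix.toEuclideanLin (P₁ * diagonal s * P₀ᵀ) (x - m₀)) =
      multivariateGaussian m₁ (P₁ * (lam • diagonal d) * P₁ᵀ) := by
  have hlin : ∀ A : Matrix (Fin n) (Fin n) ℝ, Measurable (Matrix.toEuclideanLin A) :=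
    fun A ↦ (Matrix.toEuclideanLin A).continuous_of_finiteDimensional.measurable
  have h1 := hlin (P₁ * diagonal s * P₀ᵀ)
  have h2 := hlin (P₀ * diagonal fun i ↦ √(d i))
  rw [multivariateGaussian_orthogonal_conj_diagonal m₀ P₀ hd,
    Measure.map_map (by fun_prop) (by fun_prop)]
  -- The composite map has linear part `√λ P₁ diag(s) √D`; the signs square away in its covariance.
  have hcov : (P₁ * diagonal fun i ↦ √lam * s i * √(d i)) *
      (P₁ * diagonal fun i ↦ √lam * s i * √(d i))ᵀ = P₁ * (lam • diagonal d) * P₁ᵀ := by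
    rw [mul_diagonal_mul_transpose_self, ← diagonal_smul]
    congr 3
    ext i
    have hsi : s i * s i = 1 := by rcases hs i with h | h <;> simp [h]
    calc √lam * s i * √(d i) * (√lam * s i * √(d i))
        = (√lam * √lam) * (s i * s i) * (√(d i) * √(d i)) := by ring
      _ = (lam • d) i := by
        rw [Real.mul_self_sqrt hlam, hsi, Real.mul_self_sqrt (hd i)]
        simp
  rw [← hcov, ← map_affine_stdGaussian]
  congr 1
  ext1 z
  simp only [Function.comp_apply, add_sub_cancel_left]
  congr 1
  apply WithLp.ofLp_injective
  simp only [WithLp.ofLp_smul, ofLp_toLpLin, toLin'_apply, mulVec_mulVec, ← smul_mulVec]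
  congr 1
  simp only [Matrix.mul_assoc]
  rw [← Matrix.mul_assoc P₀ᵀ P₀, transpose_mul_self_of_mem_orthogonalGroup hP₀, Matrix.one_mul,
    diagonal_mul_diagonal, ← Matrix.mul_smul, ← diagonal_smul]
  congr 2
  ext i
  simp [mul_assoc]

/-- The graph of an affine map transports a Gaussian measure to a Gaussian measure. -/
theorem isGaussian_map_prodMk_affine {E F : Type*} [NormedAddCommGroup E] [NormedSpace ℝ E]
    [FiniteDimensional ℝ E] [MeasurableSpace E] [BorelSpace E] [NormedAddCommGroup F]
    [NormedSpace ℝ F] [FiniteDimensional ℝ F] [MeasurableSpace F] [BorelSpace F]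
    (μ : Measure E) [IsGaussian μ] (A : E →ₗ[ℝ] F) (c : F) :
    IsGaussian (μ.map fun x ↦ (x, c + A x)) := by
  have : ProperSpace E := FiniteDimensional.proper_real E
  have : ProperSpace F := FiniteDimensional.proper_real F
  let L : E →L[ℝ] E × F := (ContinuousLinearMap.id ℝ E).prod A.toContinuousLinearMap
  have hL : (fun x ↦ (x, c + A x)) = (fun p : E × F ↦ (0, c) + p) ∘ L := by
    ext x <;> simp [L]
  rw [hL, ← Measure.map_map (by fun_prop) (by fun_prop)]
  infer_instance

/-- The objective of the plan induced by a map which multiplies squared distances by `c`. -/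
theorem gwObjective_map_prodMk {m n : ℕ} {μ : Measure (EuclideanSpace ℝ (Fin m))} [SFinite μ]
    {T : EuclideanSpace ℝ (Fin m) → EuclideanSpace ℝ (Fin n)} (hT : Measurable T) {c : ℝ}
    (hTc : ∀ x x', ‖T x - T x'‖ ^ 2 = c * ‖x - x'‖ ^ 2) {K : ℝ}
    (hμ : ∫⁻ x, ∫⁻ x', ENNReal.ofReal ((‖x - x'‖ ^ 2) ^ 2) ∂μ ∂μ = ENNReal.ofReal K) :
    gwObjective (μ.map fun x ↦ (x, T x)) = ENNReal.ofReal ((c - 1) ^ 2 * K) := by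
  have hm : Measurable fun x ↦ (x, T x) := measurable_id.prodMk hT
  have hF : Measurable (Function.uncurry fun z z' : EuclideanSpace ℝ (Fin m) ×
      EuclideanSpace ℝ (Fin n) ↦
      ENNReal.ofReal ((‖z.1 - z'.1‖ ^ 2 - ‖z.2 - z'.2‖ ^ 2) ^ 2)) := by
    unfold Function.uncurry
    fun_prop
  -- Equality case: on the graph the two squared distances are proportional, so `(c - 1)²` factors
  -- out pointwise.
  have h1 : ∀ x x', ENNReal.ofReal ((‖x - x'‖ ^ 2 - ‖T x - T x'‖ ^ 2) ^ 2) =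
      ENNReal.ofReal ((c - 1) ^ 2) * ENNReal.ofReal ((‖x - x'‖ ^ 2) ^ 2) := by
    intro x x'
    rw [hTc, ← ENNReal.ofReal_mul (sq_nonneg _)]
    congr 1
    ring
  have h2 := measurable_uncurry_norm_sub_pow_four (E := EuclideanSpace ℝ (Fin m))
  rw [gwObjective, lintegral_lintegral_map hm hF]
  simp_rw [h1, fun x ↦ lintegral_const_mul (μ := μ) (ENNReal.ofReal ((c - 1) ^ 2))
    (h2.of_uncurry_left (x := x))]
  rw [lintegral_const_mul _ h2.lintegral_prod_right, hμ, ← ENNReal.ofReal_mul (sq_nonneg _)]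

/-! ### The main theorem -/

theorem mainTheorem6 (n : ℕ) (m₀ m₁ : EuclideanSpace ℝ (Fin n))
    (S₀ S₁ P₀ P₁ D₀ D₁ : Matrix (Fin n) (Fin n) ℝ)
    (hS₀ : S₀.PosSemidef) (hS₁ : S₁.PosSemidef)
    (hS₀_nonsing : IsUnit S₀.det)
    (h₀ : IsSortedDiagonalization S₀ P₀ D₀) (h₁ : IsSortedDiagonalization S₁ P₁ D₁)
    (lam : ℝ) (hlam : 0 ≤ lam) (hD : D₁ = lam • D₀)
    (μ ν : Measure (EuclideanSpace ℝ (Fin n)))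
    (hμ : μ = multivariateGaussian m₀ S₀) (hν : ν = multivariateGaussian m₁ S₁) :
    GW2sq μ ν = GGW2sq μ ν ∧
    GGW2sq μ ν = ENNReal.ofReal (LGW2sq (le_refl n) D₀ D₁) ∧
    LGW2sq (le_refl n) D₀ D₁ = (lam - 1) ^ 2 * (4 * S₀.trace ^ 2 + 8 * frobNorm S₀ ^ 2) ∧
    ∀ (s : Fin n → ℝ), (∀ i, s i = 1 ∨ s i = -1) →
      ∀ T : EuclideanSpace ℝ (Fin n) → EuclideanSpace ℝ (Fin n),
        (∀ x, T x = m₁ + Real.sqrt lam •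
          Matrix.toEuclideanLin (P₁ * Matrix.diagonal s * P₀.transpose) (x - m₀)) →
        μ.map (fun x => (x, T x)) ∈ gaussianTransportPlans μ ν ∧
        gwObjective (μ.map (fun x => (x, T x))) = GW2sq μ ν := by
  obtain ⟨d, rfl⟩ : ∃ d, D₀ = Matrix.diagonal d := ⟨_, h₀.eq_diagonal⟩
  have hd : ∀ i, 0 ≤ d i := by simpa using h₀.diag_nonneg hS₀
  set K : ℝ := 4 * (∑ i, d i) ^ 2 + 8 * ∑ i, d i ^ 2 with hK
  have hK0 : 0 ≤ K := by positivity
  have hS₀K : 4 * S₀.trace ^ 2 + 8 * frobNorm S₀ ^ 2 = K := by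
    rw [h₀.trace_eq, h₀.frobNorm_eq, frobNorm_diagonal_sq, Matrix.trace_diagonal]
  have hLGW : LGW2sq (le_refl n) (Matrix.diagonal d) D₁ = (lam - 1) ^ 2 * K := by
    -- Every term scales by `(λ - 1)²`; the last two Frobenius contributions, `4 + 4`, make the 8,
    -- and the block defect vanishes since `m = n`.
    have h1 : Matrix.diagonal d - lam • Matrix.diagonal d = (1 - lam) • Matrix.diagonal d := by
      rw [sub_smul, one_smul]
    rw [LGW2sq, leadingBlock_refl, hD, h1, frobNorm_smul, frobNorm_smul, abs_of_nonneg hlam,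
      mul_pow, sq_abs, Matrix.trace_smul, Matrix.trace_diagonal, hK, ← frobNorm_diagonal_sq d,
      smul_eq_mul]
    ring
  have hμ' : μ = multivariateGaussian m₀ (P₀ * Matrix.diagonal d * P₀.transpose) := by
    rw [hμ, h₀.eq]
  have hν' : ν = multivariateGaussian m₁ (P₁ * (lam • Matrix.diagonal d) * P₁.transpose) := by
    rw [hν, h₁.eq, hD]
  have : IsGaussian μ := by rw [hμ]; infer_instance
  have hμK : ∫⁻ x, ∫⁻ x', ENNReal.ofReal ((‖x - x'‖ ^ 2) ^ 2) ∂μ ∂μ = ENNReal.ofReal K := by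
    rw [hμ', lintegral_lintegral_norm_sub_pow_four m₀ h₀.orthogonal hd]
  have hνK : ∫⁻ y, ∫⁻ y', ENNReal.ofReal ((‖y - y'‖ ^ 2) ^ 2) ∂ν ∂ν
      = ENNReal.ofReal (lam ^ 2 * K) := by
    rw [hν', ← Matrix.diagonal_smul, lintegral_lintegral_norm_sub_pow_four m₁ h₁.orthogonal
      (d := lam • d) (fun i ↦ mul_nonneg hlam (hd i))]
    congr 1
    simp only [Pi.smul_apply, smul_eq_mul, mul_pow, ← Finset.mul_sum, hK]
    ring
  have hlower : ENNReal.ofReal ((lam - 1) ^ 2 * K) ≤ GW2sq μ ν :=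
    le_iInf₂ fun π hπ ↦ ofReal_sub_one_sq_mul_le_gwObjective hπ hlam hK0 hμK hνK
  have hle : GW2sq μ ν ≤ GGW2sq μ ν := biInf_mono fun π hπ ↦ hπ.1
  have hplan : ∀ (s : Fin n → ℝ), (∀ i, s i = 1 ∨ s i = -1) →
      ∀ T : EuclideanSpace ℝ (Fin n) → EuclideanSpace ℝ (Fin n),
        (∀ x, T x = m₁ + Real.sqrt lam •
          Matrix.toEuclideanLin (P₁ * Matrix.diagonal s * P₀.transpose) (x - m₀)) →
        μ.map (fun x => (x, T x)) ∈ gaussianTransportPlans μ ν ∧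
        gwObjective (μ.map (fun x => (x, T x))) = ENNReal.ofReal ((lam - 1) ^ 2 * K) := by
    intro s hs T hT
    set A := Matrix.toEuclideanLin (P₁ * Matrix.diagonal s * P₀.transpose) with hA
    have hAm : Measurable A := A.continuous_of_finiteDimensional.measurable
    obtain rfl : T = fun x ↦ m₁ + Real.sqrt lam • A (x - m₀) := funext hT
    have hTm : Measurable fun x ↦ m₁ + Real.sqrt lam • A (x - m₀) := by fun_prop
    refine ⟨⟨⟨?_, ?_⟩, ?_⟩, gwObjective_map_prodMk hTm (fun x x' ↦ ?_) hμK⟩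
    · rw [Measure.fst_map_prodMk hTm, Measure.map_id']
    · rw [Measure.snd_map_prodMk measurable_id', hν', hμ']
      exact map_affine_multivariateGaussian_sign m₀ m₁ h₀.orthogonal P₁ hd hs hlam
    -- The centring at `m₀` is absorbed into the constant term.
    · convert isGaussian_map_prodMk_affine μ (Real.sqrt lam • A) (m₁ - Real.sqrt lam • A m₀)
        using 4
      simp only [map_sub, smul_sub, LinearMap.smul_apply]
      abel
    · rw [add_sub_add_left_eq_sub, ← smul_sub, ← map_sub, sub_sub_sub_cancel_right]
      exact norm_sq_sqrt_smul_orthogonal_sign h₀.orthogonal h₁.orthogonal hs hlam _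
  have hupper : GGW2sq μ ν ≤ ENNReal.ofReal ((lam - 1) ^ 2 * K) := by
    -- Any choice of signs would do; all `+1` is taken.
    obtain ⟨hπ, hJ⟩ := hplan (fun _ ↦ 1) (fun _ ↦ Or.inl rfl) _ fun _ ↦ rfl
    rw [← hJ]
    exact iInf₂_le _ hπ
  have hGW : GW2sq μ ν = ENNReal.ofReal ((lam - 1) ^ 2 * K) :=
    le_antisymm (hle.trans hupper) hlower
  have hGGW : GGW2sq μ ν = ENNReal.ofReal ((lam - 1) ^ 2 * K) :=
    le_antisymm hupper (hlower.trans hle)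
  rw [hLGW, hS₀K, hGW, hGGW]
  exact ⟨rfl, rfl, rfl, hplan⟩
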